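/- All Banach spaces are real; $X^*$ is the topological dual and $B_X$ the closed unit ball of $X$. A lattice homomorphism between Banach lattices is a bounded linear operator preserving the lattice operations $\vee,\wedge$. For a positively homogeneous function $f:X^*\to\mathbb R$ (i.e. $f(\lambda x^*)=\lambda f(x^*)$ for all $\lambda>0$, $x^*\in X^*$) put $$\|f\|_{FBL[X]}:=\sup\Big\{\sum_{i=1}^n|f(x_i^*)| : n\in\mathbb N,\ x_1^*,\dots,x_n^*\in X^*,\ \sup_{x\in B_X}\sum_{i=1}^n|x_i^*(x)|\le 1\Big\}\in[0,\infty].$$ Let $H_0[X]$ be the Banach lattice of all positively homogeneous $f$ with $\|f\|_{FBL[X]}<\infty$, with this norm and the pointwise order. For $x\in X$ let $\delta_X(x)(x^*):=x^*(x)$. The free Banach lattice $FBL[X]$ is the closed vector sublattice of $H_0[X]$ generated by $\{\delta_X(x):x\in X\}$. If $X$ is a Banach lattice, $\beta_X:FBL[X]\to X$ denotes the unique lattice homomorphism with $\beta_X\circ\delta_X=\mathrm{id}_X$. **Theorem.** Let $X$ be a Banach space with a $1$-unconditional Schauder basis $(e_n)_{n\in\mathbb N}$, i.e. $\|\sum_{i=1}^n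 a_ie_i\|\le\|\sum_{i=1}^n c_ie_i\|$ whenever $n\in\mathbb N$ and $a_i,c_i\in\mathbb R$ satisfy $|a_i|\le|c_i|$ for $i=1,\dots,n$. Consider $X$ as a Banach lattice with the coordinatewise order: $x\le y$ if and only if $e_n^*(x)\le e_n^*(y)$ for all $n$, where $(e_n^*)$ are the biorthogonal functionals. Then $X$ has the isometric lattice-lifting property: the map $\beta_X$ exists, and there is a lattice homomorphism $T:X\to FBL[X]$ with $\beta_X\circ T=\mathrm{id}_X$ and $\|T\|=1$. -/

import Mathlib

open scoped ENNReal

/-! ### Banach lattices and lattice homomorphisms -/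

/-- A real normed space with a lattice order is a Banach lattice if it is complete, the order is
compatible with the vector space structure, and `|x| ≤ |y|` implies `‖x‖ ≤ ‖y‖`. -/
class IsBanachLattice (X : Type*) [NormedAddCommGroup X] [NormedSpace ℝ X] [Lattice X] : Prop
    extends CompleteSpace X, IsOrderedAddMonoid X, PosSMulMono ℝ X, HasSolidNorm X

/-- A lattice homomorphism is a bounded linear operator that preserves the lattice operations. -/
structure IsLatticeHom {X Y : Type*} [NormedAddCommGroup X] [NormedSpace ℝ X] [Lattice X]
    [NormedAddCommGroup Y] [NormedSpace ℝ Y] [Lattice Y] (T : X →L[ℝ] Y) : Prop where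
  map_sup : ∀ x y, T (x ⊔ y) = T x ⊔ T y
  map_inf : ∀ x y, T (x ⊓ y) = T x ⊓ T y

/-! ### The Banach lattice `H₀[E]` -/

section H0

variable (E : Type*) [NormedAddCommGroup E] [NormedSpace ℝ E]

/-- A finite family of functionals with `sup_{‖v‖ ≤ 1} ∑ i, |φ i v| ≤ 1`. -/
def IsAdmissible {E : Type*} [NormedAddCommGroup E] [NormedSpace ℝ E] {n : ℕ}
    (φ : Fin n → StrongDual ℝ E) : Prop :=
  ∀ v : E, ‖v‖ ≤ 1 → ∑ i, |φ i v| ≤ 1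

/-- The extended free norm of a function on the dual: the supremum of the sums `∑ i, |f (φ i)|`
over all admissible finite families of functionals. -/
noncomputable def freeENorm {E : Type*} [NormedAddCommGroup E] [NormedSpace ℝ E]
    (f : StrongDual ℝ E → ℝ) : ℝ≥0∞ :=
  ⨆ (n : ℕ) (φ : Fin n → StrongDual ℝ E) (_ : IsAdmissible φ), ∑ i, ENNReal.ofReal |f (φ i)|

/-- Positive homogeneity of a function on the dual. -/
def IsPosHomogeneous {E : Type*} [NormedAddCommGroup E] [NormedSpace ℝ E]
    (f : StrongDual ℝ E → ℝ) : Prop :=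
  ∀ c : ℝ, 0 < c → ∀ φ, f (c • φ) = c * f φ

variable {E}

lemma sum_le_freeENorm (f : StrongDual ℝ E → ℝ) {n : ℕ} {φ : Fin n → StrongDual ℝ E}
    (h : IsAdmissible φ) : ∑ i, ENNReal.ofReal |f (φ i)| ≤ freeENorm f :=
  le_iSup_of_le n <| le_iSup_of_le φ <| le_iSup_of_le h le_rfl

lemma freeENorm_le {f : StrongDual ℝ E → ℝ} {C : ℝ≥0∞}
    (h : ∀ (n : ℕ) (φ : Fin n → StrongDual ℝ E), IsAdmissible φ →
      ∑ i, ENNReal.ofReal |f (φ i)| ≤ C) : freeENorm f ≤ C :=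
  iSup_le fun n => iSup_le fun φ => iSup_le fun hφ => h n φ hφ

lemma freeENorm_mono {f g : StrongDual ℝ E → ℝ} (h : ∀ φ, |f φ| ≤ |g φ|) :
    freeENorm f ≤ freeENorm g :=
  freeENorm_le fun _ φ hφ => (Finset.sum_le_sum fun i _ => ENNReal.ofReal_le_ofReal (h (φ i))).trans
    (sum_le_freeENorm g hφ)

lemma freeENorm_zero : freeENorm (0 : StrongDual ℝ E → ℝ) = 0 :=
  le_antisymm (freeENorm_le fun _ _ _ => by simp) bot_le

lemma freeENorm_add_le (f g : StrongDual ℝ E → ℝ) :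
    freeENorm (f + g) ≤ freeENorm f + freeENorm g :=
  freeENorm_le fun _ φ hφ => by
    refine le_trans (Finset.sum_le_sum fun i _ => ?_)
      (Finset.sum_add_distrib.le.trans
        (add_le_add (sum_le_freeENorm f hφ) (sum_le_freeENorm g hφ)))
    rw [← ENNReal.ofReal_add (abs_nonneg _) (abs_nonneg _)]
    exact ENNReal.ofReal_le_ofReal (abs_add_le _ _)

lemma freeENorm_smul_le (c : ℝ) (f : StrongDual ℝ E → ℝ) :
    freeENorm (c • f) ≤ ENNReal.ofReal |c| * freeENorm f :=
  freeENorm_le fun _ φ hφ => by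
    refine le_trans (le_of_eq ?_) (mul_le_mul_right (sum_le_freeENorm f hφ) _)
    rw [Finset.mul_sum]
    refine Finset.sum_congr rfl fun i _ => ?_
    rw [← ENNReal.ofReal_mul (abs_nonneg _), ← abs_mul]
    rfl

lemma isAdmissible_singleton {φ : StrongDual ℝ E} (h : ‖φ‖ ≤ 1) :
    IsAdmissible (fun _ : Fin 1 => φ) := fun v hv => by
  simpa using (φ.le_opNorm v).trans (mul_le_one₀ h (norm_nonneg _) hv)

lemma abs_le_freeENorm (f : StrongDual ℝ E → ℝ) {φ : StrongDual ℝ E} (h : ‖φ‖ ≤ 1) :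
    ENNReal.ofReal |f φ| ≤ freeENorm f := by
  simpa using sum_le_freeENorm f (isAdmissible_singleton h)

variable (E) in
/-- The positively homogeneous functions on the dual with finite free norm. -/
def h0Submodule : Submodule ℝ (StrongDual ℝ E → ℝ) where
  carrier := {f | IsPosHomogeneous f ∧ freeENorm f < ∞}
  zero_mem' := ⟨fun _ _ _ => by simp, by simp [freeENorm_zero]⟩
  add_mem' := fun {f g} hf hg =>
    ⟨fun c hc φ => by simp only [Pi.add_apply, hf.1 c hc, hg.1 c hc]; ring,
      (freeENorm_add_le f g).trans_lt (ENNReal.add_lt_top.2 ⟨hf.2, hg.2⟩)⟩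
  smul_mem' := fun a f hf =>
    ⟨fun c hc φ => by simp only [Pi.smul_apply, smul_eq_mul, hf.1 c hc]; ring,
      (freeENorm_smul_le a f).trans_lt (ENNReal.mul_lt_top ENNReal.ofReal_lt_top hf.2)⟩

lemma sup_mem_h0Submodule {f g : StrongDual ℝ E → ℝ} (hf : f ∈ h0Submodule E)
    (hg : g ∈ h0Submodule E) : f ⊔ g ∈ h0Submodule E := by
  refine ⟨fun c hc φ => ?_, ?_⟩
  · simp only [Pi.sup_apply, hf.1 c hc, hg.1 c hc]
    exact (mul_max_of_nonneg _ _ hc.le).symm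
  · refine lt_of_le_of_lt ((freeENorm_mono (g := |f| + |g|) fun φ => ?_).trans
      (freeENorm_add_le _ _)) (ENNReal.add_lt_top.2
        ⟨(freeENorm_mono fun φ => ?_).trans_lt hf.2, (freeENorm_mono fun φ => ?_).trans_lt hg.2⟩)
    · simp only [Pi.sup_apply, Pi.add_apply, Pi.abs_apply]
      rw [abs_of_nonneg (add_nonneg (abs_nonneg (f φ)) (abs_nonneg (g φ)))]
      exact abs_max_le_max_abs_abs.trans
        (max_le_add_of_nonneg (abs_nonneg _) (abs_nonneg _))
    · simp
    · simp

lemma inf_mem_h0Submodule {f g : StrongDual ℝ E → ℝ} (hf : f ∈ h0Submodule E)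
    (hg : g ∈ h0Submodule E) : f ⊓ g ∈ h0Submodule E := by
  have := neg_mem (sup_mem_h0Submodule (neg_mem hf) (neg_mem hg))
  rwa [neg_sup, neg_neg, neg_neg] at this

variable (E) in
/-- `H₀[E]`: the positively homogeneous functions on the dual of `E` with finite free norm. -/
def H0 : Type _ := h0Submodule E

namespace H0

noncomputable instance : AddCommGroup (H0 E) := inferInstanceAs (AddCommGroup (h0Submodule E))

noncomputable instance : Module ℝ (H0 E) := inferInstanceAs (Module ℝ (h0Submodule E))

instance : CoeFun (H0 E) (fun _ => StrongDual ℝ E → ℝ) := ⟨fun f => f.1⟩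

/-- The pointwise order. -/
noncomputable instance : Lattice (H0 E) :=
  Subtype.lattice (P := fun f => f ∈ h0Submodule E) (fun _ _ hf hg => sup_mem_h0Submodule hf hg)
    (fun _ _ hf hg => inf_mem_h0Submodule hf hg)

@[ext] lemma ext {f g : H0 E} (h : ∀ φ, f φ = g φ) : f = g := Subtype.ext (funext h)

@[simp] lemma zero_apply (φ : StrongDual ℝ E) : (0 : H0 E) φ = 0 := rfl
@[simp] lemma add_apply (f g : H0 E) (φ : StrongDual ℝ E) : (f + g) φ = f φ + g φ := rfl
@[simp] lemma neg_apply (f : H0 E) (φ : StrongDual ℝ E) : (-f) φ = -f φ := rfl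
@[simp] lemma sub_apply (f g : H0 E) (φ : StrongDual ℝ E) : (f - g) φ = f φ - g φ := rfl
@[simp] lemma smul_apply (c : ℝ) (f : H0 E) (φ : StrongDual ℝ E) : (c • f) φ = c * f φ := rfl
@[simp] lemma sup_apply (f g : H0 E) (φ : StrongDual ℝ E) : (f ⊔ g) φ = f φ ⊔ g φ := rfl
@[simp] lemma inf_apply (f g : H0 E) (φ : StrongDual ℝ E) : (f ⊓ g) φ = f φ ⊓ g φ := rfl
@[simp] lemma abs_apply (f : H0 E) (φ : StrongDual ℝ E) : |f| φ = |f φ| := rfl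
lemma le_def {f g : H0 E} : f ≤ g ↔ ∀ φ, f φ ≤ g φ := Iff.rfl

lemma freeENorm_ne_top (f : H0 E) : freeENorm (f : StrongDual ℝ E → ℝ) ≠ ∞ := f.2.2.ne

lemma eq_zero_of_freeENorm {f : H0 E} (h : freeENorm (f : StrongDual ℝ E → ℝ) = 0) : f = 0 := by
  ext φ
  have hc : (0 : ℝ) < (‖φ‖ + 1)⁻¹ := by positivity
  have h1 : ‖(‖φ‖ + 1)⁻¹ • φ‖ ≤ 1 := by
    rw [norm_smul, Real.norm_of_nonneg hc.le, inv_mul_le_iff₀ (by positivity)]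
    linarith
  have h2 := abs_le_freeENorm f.1 h1
  rw [h, nonpos_iff_eq_zero, ENNReal.ofReal_eq_zero, f.2.1 _ hc] at h2
  have h3 := abs_nonpos_iff.1 h2
  exact (mul_eq_zero.1 h3).resolve_left hc.ne'

/-- The free norm on `H₀[E]`. -/
noncomputable instance : NormedAddCommGroup (H0 E) :=
  AddGroupNorm.toNormedAddCommGroup
    { toFun := fun f => (freeENorm (f : StrongDual ℝ E → ℝ)).toReal
      map_zero' := by
        change (freeENorm (0 : StrongDual ℝ E → ℝ)).toReal = 0
        simp [freeENorm_zero]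
      add_le' := fun f g => by
        rw [← ENNReal.toReal_add f.freeENorm_ne_top g.freeENorm_ne_top]
        exact ENNReal.toReal_mono (ENNReal.add_ne_top.2 ⟨f.freeENorm_ne_top, g.freeENorm_ne_top⟩)
          (freeENorm_add_le _ _)
      neg' := fun f => by
        congr 1
        exact le_antisymm (freeENorm_mono fun φ => by simp) (freeENorm_mono fun φ => by simp)
      eq_zero_of_map_eq_zero' := fun f hf =>
        eq_zero_of_freeENorm ((ENNReal.toReal_eq_zero_iff _).1 hf |>.resolve_right
          f.freeENorm_ne_top) }

lemma norm_def (f : H0 E) : ‖f‖ = (freeENorm (f : StrongDual ℝ E → ℝ)).toReal := rfl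

lemma ofReal_norm (f : H0 E) : ENNReal.ofReal ‖f‖ = freeENorm (f : StrongDual ℝ E → ℝ) :=
  ENNReal.ofReal_toReal f.freeENorm_ne_top

noncomputable instance : NormedSpace ℝ (H0 E) where
  norm_smul_le := fun c f => by
    rw [norm_def, norm_def, Real.norm_eq_abs, ← ENNReal.toReal_ofReal (abs_nonneg c),
      ← ENNReal.toReal_mul]
    exact ENNReal.toReal_mono (ENNReal.mul_ne_top ENNReal.ofReal_ne_top f.freeENorm_ne_top)
      (freeENorm_smul_le c f.1)

lemma sum_abs_le_norm (f : H0 E) {n : ℕ} {φ : Fin n → StrongDual ℝ E} (h : IsAdmissible φ) :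
    ∑ i, |f (φ i)| ≤ ‖f‖ := by
  have := sum_le_freeENorm f.1 h
  rwa [← ENNReal.ofReal_sum_of_nonneg (fun _ _ => abs_nonneg _), ← ofReal_norm,
    ENNReal.ofReal_le_ofReal_iff (norm_nonneg _)] at this

lemma abs_apply_le (f : H0 E) (φ : StrongDual ℝ E) : |f φ| ≤ (‖φ‖ + 1) * ‖f‖ := by
  have hc : (0 : ℝ) < (‖φ‖ + 1)⁻¹ := by positivity
  have h1 : ‖(‖φ‖ + 1)⁻¹ • φ‖ ≤ 1 := by
    rw [norm_smul, Real.norm_of_nonneg hc.le, inv_mul_le_iff₀ (by positivity)]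
    linarith
  have h2 := f.sum_abs_le_norm (isAdmissible_singleton h1)
  simp only [Finset.univ_unique, Finset.sum_singleton, f.2.1 _ hc, abs_mul, abs_of_pos hc] at h2
  rwa [inv_mul_le_iff₀ (by positivity)] at h2

instance : CompleteSpace (H0 E) := by
  refine Metric.complete_of_cauchySeq_tendsto fun u hu => ?_
  have hpt : ∀ φ, CauchySeq fun k => u k φ := fun φ => by
    rw [Metric.cauchySeq_iff] at hu ⊢
    intro ε hε
    obtain ⟨N, hN⟩ := hu (ε / (‖φ‖ + 1)) (by positivity)
    refine ⟨N, fun m hm n hn => ?_⟩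
    have h := hN m hm n hn
    rw [dist_eq_norm, lt_div_iff₀ (by positivity)] at h
    calc dist (u m φ) (u n φ) = |(u m - u n) φ| := Real.dist_eq _ _
      _ ≤ (‖φ‖ + 1) * ‖u m - u n‖ := abs_apply_le _ _
      _ < ε := by linarith
  choose g hg using fun φ => cauchySeq_tendsto_of_complete (hpt φ)
  have hbound : ∀ ε > 0, ∃ N, ∀ m ≥ N, freeENorm (fun φ => u m φ - g φ) ≤ ENNReal.ofReal ε := by
    intro ε hε
    obtain ⟨N, hN⟩ := Metric.cauchySeq_iff.1 hu ε hε
    refine ⟨N, fun m hm => freeENorm_le fun n φ hφ => ?_⟩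
    rw [← ENNReal.ofReal_sum_of_nonneg (fun _ _ => abs_nonneg _)]
    refine ENNReal.ofReal_le_ofReal (le_of_tendsto (f := fun k => ∑ i, |u m (φ i) - u k (φ i)|)
      (x := Filter.atTop) ?_ ?_)
    · exact tendsto_finsetSum _ fun i _ => (tendsto_const_nhds.sub (hg (φ i))).abs
    · filter_upwards [Filter.eventually_ge_atTop N] with k hk
      have h := (hN m hm k hk).le
      rw [dist_eq_norm] at h
      exact ((u m - u k).sum_abs_le_norm hφ).trans h
  have hmem : g ∈ h0Submodule E := by
    refine ⟨fun c hc φ => ?_, ?_⟩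
    · refine tendsto_nhds_unique (hg (c • φ)) (((hg φ).const_mul c).congr fun k => ?_)
      exact ((u k).2.1 c hc φ).symm
    · obtain ⟨N, hN⟩ := hbound 1 one_pos
      have h : g = (u N).1 + (-1 : ℝ) • (fun φ => u N φ - g φ) := by
        ext φ; simp
      rw [h]
      refine (freeENorm_add_le _ _).trans_lt (ENNReal.add_lt_top.2 ⟨(u N).2.2,
        (freeENorm_smul_le _ _).trans_lt (ENNReal.mul_lt_top ENNReal.ofReal_lt_top
          ((hN N le_rfl).trans_lt ENNReal.ofReal_lt_top))⟩)
  let g' : H0 E := ⟨g, hmem⟩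
  refine ⟨g', ?_⟩
  rw [Metric.tendsto_atTop]
  intro ε hε
  obtain ⟨N, hN⟩ := hbound (ε / 2) (half_pos hε)
  refine ⟨N, fun m hm => ?_⟩
  rw [dist_eq_norm]
  refine lt_of_le_of_lt ?_ (half_lt_self hε)
  exact ENNReal.toReal_le_of_le_ofReal (half_pos hε).le (hN m hm)

instance : IsBanachLattice (H0 E) where
  add_le_add_left := fun _ _ h k φ => add_le_add_left (h φ) (k φ)
  smul_le_smul_of_nonneg_left := fun _ hc _ _ h φ => mul_le_mul_of_nonneg_left (h φ) hc
  solid := fun _ g h => ENNReal.toReal_mono g.freeENorm_ne_top (freeENorm_mono h)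

end H0

end H0

/-! ### The free Banach lattice generated by a Banach space -/

section FBL

variable {E : Type*} [NormedAddCommGroup E] [NormedSpace ℝ E]

lemma freeENorm_eval_le (x : E) :
    freeENorm (fun φ : StrongDual ℝ E => φ x) ≤ ENNReal.ofReal ‖x‖ :=
  freeENorm_le fun n φ hφ => by
    rw [← ENNReal.ofReal_sum_of_nonneg (fun _ _ => abs_nonneg _)]
    refine ENNReal.ofReal_le_ofReal ?_
    rcases eq_or_ne x 0 with rfl | hx
    · simp
    have hx' : 0 < ‖x‖ := norm_pos_iff.2 hx
    have h := hφ (‖x‖⁻¹ • x) (by rw [norm_smul, norm_inv, norm_norm, inv_mul_cancel₀ hx'.ne'])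
    simp only [map_smul, smul_eq_mul, abs_mul, abs_inv, abs_norm, ← Finset.mul_sum] at h
    rwa [inv_mul_le_iff₀ hx', mul_one] at h

/-- The evaluation `φ ↦ φ x` as an element of `H₀[E]`. -/
def H0.eval (x : E) : H0 E :=
  ⟨fun φ => φ x, fun c _ φ => by simp, (freeENorm_eval_le x).trans_lt ENNReal.ofReal_lt_top⟩

@[simp] lemma H0.eval_apply (x : E) (φ : StrongDual ℝ E) : H0.eval x φ = φ x := rfl

variable (E) in
/-- `FBL[E]`: the closed vector sublattice of `H₀[E]` generated by the evaluations at the points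
of `E`. -/
noncomputable def FBL : Submodule ℝ (H0 E) :=
  sInf {S : Submodule ℝ (H0 E) | IsClosed (S : Set (H0 E)) ∧
    (∀ f ∈ S, ∀ g ∈ S, f ⊔ g ∈ S ∧ f ⊓ g ∈ S) ∧ ∀ x : E, H0.eval x ∈ S}

namespace FBL

lemma sup_mem {f g : H0 E} (hf : f ∈ FBL E) (hg : g ∈ FBL E) : f ⊔ g ∈ FBL E := by
  simp only [FBL, Submodule.mem_sInf] at hf hg ⊢
  exact fun S hS => (hS.2.1 f (hf S hS) g (hg S hS)).1

lemma inf_mem {f g : H0 E} (hf : f ∈ FBL E) (hg : g ∈ FBL E) : f ⊓ g ∈ FBL E := by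
  simp only [FBL, Submodule.mem_sInf] at hf hg ⊢
  exact fun S hS => (hS.2.1 f (hf S hS) g (hg S hS)).2

lemma eval_mem (x : E) : H0.eval x ∈ FBL E := by
  simp only [FBL, Submodule.mem_sInf]
  exact fun S hS => hS.2.2 x

lemma isClosed : IsClosed (FBL E : Set (H0 E)) := by
  rw [FBL, Submodule.coe_sInf]
  exact isClosed_biInter fun S hS => hS.1

/-- The pointwise order on `FBL[E]`. -/
noncomputable instance : Lattice (FBL E) :=
  Subtype.lattice (P := fun f => f ∈ FBL E) (fun _ _ hf hg => sup_mem hf hg)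
    (fun _ _ hf hg => inf_mem hf hg)

@[simp] lemma coe_sup (f g : FBL E) : ((f ⊔ g : FBL E) : H0 E) = f.1 ⊔ g.1 := rfl
@[simp] lemma coe_inf (f g : FBL E) : ((f ⊓ g : FBL E) : H0 E) = f.1 ⊓ g.1 := rfl

instance : IsBanachLattice (FBL E) where
  toCompleteSpace := isClosed.completeSpace_coe
  add_le_add_left := fun _ _ h k => add_le_add_left (α := H0 E) h k.1
  smul_le_smul_of_nonneg_left := fun _ hc _ _ h =>
    smul_le_smul_of_nonneg_left (β := H0 E) h hc
  solid := fun _ _ h => HasSolidNorm.solid (α := H0 E) h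

variable (E) in
/-- The canonical linear isometry `δ : E → FBL[E]`, `δ x φ = φ x`. -/
noncomputable def delta : E →ₗᵢ[ℝ] FBL E where
  toFun := fun x => ⟨H0.eval x, eval_mem x⟩
  map_add' := fun x y => Subtype.ext (H0.ext fun φ => map_add φ x y)
  map_smul' := fun c x => Subtype.ext (H0.ext fun φ => map_smul φ c x)
  norm_map' := fun x => by
    change ‖H0.eval x‖ = ‖x‖
    refine le_antisymm (ENNReal.toReal_le_of_le_ofReal (norm_nonneg _) (freeENorm_eval_le x)) ?_
    obtain ⟨φ, hφ, hx⟩ := exists_dual_vector'' ℝ x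
    have h := (H0.eval x).sum_abs_le_norm (isAdmissible_singleton hφ)
    simpa [hx] using h

@[simp] lemma delta_apply (x : E) (φ : StrongDual ℝ E) : (delta E x).1 φ = φ x := rfl

end FBL

end FBL

/-! ### The isometric lattice-lifting property -/

/-- `β : FBL[X] → X` is the canonical map `β_X`: a lattice homomorphism with `β ∘ δ = id`.
There is at most one such map, see `IsCanonicalMap.unique`. -/
structure IsCanonicalMap {X : Type*} [NormedAddCommGroup X] [NormedSpace ℝ X] [Lattice X]
    (β : FBL X →L[ℝ] X) : Prop where
  isLatticeHom : IsLatticeHom β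
  apply_delta : ∀ x, β (FBL.delta X x) = x

lemma IsCanonicalMap.unique {X : Type*} [NormedAddCommGroup X] [NormedSpace ℝ X] [Lattice X]
    {β γ : FBL X →L[ℝ] X} (hβ : IsCanonicalMap β) (hγ : IsCanonicalMap γ) : β = γ := by
  let S : Submodule ℝ (H0 X) := (LinearMap.eqLocus β.toLinearMap γ.toLinearMap).map (FBL X).subtype
  have hS : ∀ {f : H0 X}, f ∈ S ↔ ∃ h : f ∈ FBL X, β ⟨f, h⟩ = γ ⟨f, h⟩ := by
    intro f
    simp [S, LinearMap.mem_eqLocus]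
  have hle : FBL X ≤ S := by
    refine sInf_le ⟨?_, fun f hf g hg => ?_, fun x => ?_⟩
    · have h : IsClosed {f : FBL X | β f = γ f} := isClosed_eq β.continuous γ.continuous
      have h' := FBL.isClosed.isClosedEmbedding_subtypeVal.isClosedMap _ h
      have h2 : (S : Set (H0 X)) = Subtype.val '' {f : FBL X | β f = γ f} := by
        ext f
        simp only [SetLike.mem_coe, hS, Set.mem_image, Set.mem_ofPred_eq]
        exact ⟨fun ⟨h, e⟩ => ⟨⟨f, h⟩, e, rfl⟩, fun ⟨u, e, hu⟩ => hu ▸ ⟨u.2, e⟩⟩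
      rw [h2]
      exact h'
    · obtain ⟨hf, hf'⟩ := hS.1 hf
      obtain ⟨hg, hg'⟩ := hS.1 hg
      refine ⟨hS.2 ⟨FBL.sup_mem hf hg, ?_⟩, hS.2 ⟨FBL.inf_mem hf hg, ?_⟩⟩
      · have h1 := hβ.isLatticeHom.map_sup ⟨f, hf⟩ ⟨g, hg⟩
        rw [hf', hg', ← hγ.isLatticeHom.map_sup] at h1
        exact h1
      · have h1 := hβ.isLatticeHom.map_inf ⟨f, hf⟩ ⟨g, hg⟩
        rw [hf', hg', ← hγ.isLatticeHom.map_inf] at h1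
        exact h1
    · exact hS.2 ⟨FBL.eval_mem x, (hβ.apply_delta x).trans (hγ.apply_delta x).symm⟩
  ext f
  exact (hS.1 (hle f.2)).2

/-- The isometric lattice-lifting property of a Banach lattice `X`: the canonical map
`β_X : FBL[X] → X` exists and has a right inverse `T` that is a lattice homomorphism
of norm one. -/
def HasIsometricLatticeLifting (X : Type*) [NormedAddCommGroup X] [NormedSpace ℝ X] [Lattice X]
    [IsBanachLattice X] : Prop :=
  ∃ β : FBL X →L[ℝ] X, IsCanonicalMap β ∧
    ∃ T : X →L[ℝ] FBL X, IsLatticeHom T ∧ β.comp T = ContinuousLinearMap.id ℝ X ∧ ‖T‖ = 1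

/-! ### 1-unconditional bases and the coordinatewise order -/

/-- A Schauder basis is 1-unconditional if `|a i| ≤ |c i|` for all `i < n` implies
`‖∑ i < n, a i • e i‖ ≤ ‖∑ i < n, c i • e i‖`. -/
def IsOneUnconditional {X : Type*} [NormedAddCommGroup X] [NormedSpace ℝ X]
    (b : SchauderBasis ℝ X) : Prop :=
  ∀ (n : ℕ) (a c : ℕ → ℝ), (∀ i < n, |a i| ≤ |c i|) →
    ‖∑ i ∈ Finset.range n, a i • b i‖ ≤ ‖∑ i ∈ Finset.range n, c i • b i‖

namespace IsOneUnconditional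

variable {X : Type*} [NormedAddCommGroup X] [NormedSpace ℝ X] {b : SchauderBasis ℝ X}

lemma tendsto_sum (b : SchauderBasis ℝ X) (x : X) :
    Filter.Tendsto (fun n => ∑ i ∈ Finset.range n, b.coord i x • b i) Filter.atTop (nhds x) := by
  simpa using SchauderBasis.tendsto_proj b x

lemma coord_ext (b : SchauderBasis ℝ X) {x y : X} (h : ∀ n, b.coord n x = b.coord n y) :
    x = y :=
  tendsto_nhds_unique (tendsto_sum b x) (by simpa only [h] using tendsto_sum b y)

lemma norm_le (hb : IsOneUnconditional b) {x y : X} (h : ∀ n, |b.coord n x| ≤ |b.coord n y|) :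
    ‖x‖ ≤ ‖y‖ :=
  le_of_tendsto_of_tendsto' (tendsto_sum b x).norm (tendsto_sum b y).norm
    fun n => hb n _ _ fun i _ => h i

lemma exists_coord_eq [CompleteSpace X] (hb : IsOneUnconditional b) (x : X) (d : ℕ → ℝ)
    (hd : ∀ n, |d n| ≤ |b.coord n x|) : ∃ z : X, ∀ n, b.coord n z = d n := by
  have key : ∀ m n : ℕ, m ≤ n →
      ‖(∑ i ∈ Finset.range n, d i • b i) - ∑ i ∈ Finset.range m, d i • b i‖ ≤
      ‖(∑ i ∈ Finset.range n, b.coord i x • b i) - ∑ i ∈ Finset.range m, b.coord i x • b i‖ := by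
    intro m n hmn
    have haux : ∀ c : ℕ → ℝ, (∑ i ∈ Finset.range n, c i • b i) - ∑ i ∈ Finset.range m, c i • b i =
        ∑ i ∈ Finset.range n, (if i < m then 0 else c i) • b i := by
      intro c
      have h1 : ∑ i ∈ Finset.range m, c i • b i =
          ∑ i ∈ Finset.range n, (if i < m then c i else 0) • b i := by
        rw [← Finset.sum_subset (Finset.range_mono hmn)]
        · exact Finset.sum_congr rfl fun i hi => by rw [if_pos (Finset.mem_range.1 hi)]
        · intro i _ hi
          rw [if_neg (by simpa using hi), zero_smul]
      rw [h1, ← Finset.sum_sub_distrib]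
      refine Finset.sum_congr rfl fun i _ => ?_
      split_ifs <;> simp
    rw [haux, haux]
    refine hb n _ _ fun i _ => ?_
    split_ifs
    · simp
    · exact hd i
  have hcs : CauchySeq fun n => ∑ i ∈ Finset.range n, d i • b i := by
    have hx := (tendsto_sum b x).cauchySeq
    rw [Metric.cauchySeq_iff'] at hx ⊢
    intro ε hε
    obtain ⟨N, hN⟩ := hx ε hε
    refine ⟨N, fun n hn => ?_⟩
    have h := hN n hn
    rw [dist_eq_norm] at h ⊢
    exact (key N n hn).trans_lt h
  obtain ⟨z, hz⟩ := cauchySeq_tendsto_of_complete hcs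
  refine ⟨z, fun k => tendsto_nhds_unique (((b.coord k).continuous.tendsto z).comp hz)
    (tendsto_const_nhds.congr' ?_)⟩
  filter_upwards [Filter.eventually_gt_atTop k] with n hn
  simp [b.ortho, Pi.single_apply, hn]

/-- The vector with coordinates `|e_n^*(x)|`. -/
noncomputable def absVec [CompleteSpace X] (hb : IsOneUnconditional b) (x : X) : X :=
  (hb.exists_coord_eq x (fun n => |b.coord n x|) fun _ => (abs_abs _).le).choose

@[simp] lemma coord_absVec [CompleteSpace X] (hb : IsOneUnconditional b) (x : X) (n : ℕ) :
    b.coord n (hb.absVec x) = |b.coord n x| :=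
  (hb.exists_coord_eq x (fun n => |b.coord n x|) fun _ => (abs_abs _).le).choose_spec n

/-- The coordinatewise order of a 1-unconditional basis: `x ≤ y` iff `e_n^*(x) ≤ e_n^*(y)`
for all `n`. It is a lattice order, with coordinatewise maxima and minima. -/
@[reducible] noncomputable def coordinatewiseLattice [CompleteSpace X]
    (hb : IsOneUnconditional b) : Lattice X where
  le := fun x y => ∀ n, b.coord n x ≤ b.coord n y
  le_refl := fun _ _ => le_rfl
  le_trans := fun _ _ _ h h' n => (h n).trans (h' n)
  le_antisymm := fun _ _ h h' => coord_ext b fun n => le_antisymm (h n) (h' n)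
  sup := fun x y => (2⁻¹ : ℝ) • (x + y + hb.absVec (x - y))
  inf := fun x y => (2⁻¹ : ℝ) • (x + y - hb.absVec (x - y))
  le_sup_left := fun x y n => by
    have := neg_abs_le (b.coord n x - b.coord n y)
    have := le_abs_self (b.coord n x - b.coord n y)
    simp only [map_smul, map_add, coord_absVec, map_sub, smul_eq_mul]
    linarith
  le_sup_right := fun x y n => by
    have := neg_abs_le (b.coord n x - b.coord n y)
    simp only [map_smul, map_add, coord_absVec, map_sub, smul_eq_mul]
    linarith
  sup_le := fun x y z h h' n => by
    have h1 := h n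
    have h2 := h' n
    simp only [map_smul, map_add, coord_absVec, map_sub, smul_eq_mul]
    rcases abs_cases (b.coord n x - b.coord n y) with h3 | h3 <;> linarith
  inf_le_left := fun x y n => by
    have := neg_abs_le (b.coord n x - b.coord n y)
    simp only [map_smul, map_add, coord_absVec, map_sub, smul_eq_mul]
    linarith
  inf_le_right := fun x y n => by
    have := le_abs_self (b.coord n x - b.coord n y)
    simp only [map_smul, map_add, coord_absVec, map_sub, smul_eq_mul]
    linarith
  le_inf := fun x y z h h' n => by
    have h1 := h n
    have h2 := h' n
    simp only [map_smul, map_add, coord_absVec, map_sub, smul_eq_mul]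
    rcases abs_cases (b.coord n y - b.coord n z) with h3 | h3 <;> linarith

/-- With the coordinatewise order, the space is a Banach lattice. -/
theorem isBanachLattice [hX : CompleteSpace X] (hb : IsOneUnconditional b) :
    @IsBanachLattice X _ _ hb.coordinatewiseLattice := by
  let _ := hb.coordinatewiseLattice
  have habs : ∀ (x : X) (n : ℕ), b.coord n |x| = |b.coord n x| := fun x n => by
    change b.coord n ((2⁻¹ : ℝ) • (x + -x + hb.absVec (x - -x))) = _
    simp only [map_smul, map_add, coord_absVec, smul_eq_mul, sub_neg_eq_add,
      add_neg_cancel, zero_add, ← two_mul, abs_mul, abs_two]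
    ring
  exact
    { toCompleteSpace := hX
      add_le_add_left := fun x y h z n => by
        simp only [map_add]
        exact add_le_add_left (h n) _
      smul_le_smul_of_nonneg_left := fun c hc x y h n => by
        simp only [map_smul, smul_eq_mul]
        exact mul_le_mul_of_nonneg_left (h n) hc
      solid := fun x y h => hb.norm_le fun n => by
        have := h n
        rwa [habs, habs] at this }

end IsOneUnconditional

/-!
Write `e n` for the basis vectors. Both maps are determined by coordinates.

The canonical map sends `f ∈ FBL[X]` to the vector with coordinates `f (e_n^*)`. Such a vector exists
and has norm at most `‖f‖`: the norm bound (`norm_le_of_coord_eq`) holds for all `f ∈ H₀[X]` for which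
the vector exists, by testing `f` on the admissible families `|ψ (e n)| • e_n^*`, `n < N`, with `ψ` in
the dual unit ball; hence these `f` form a closed sublattice, which contains the evaluations
(`exists_coord_eq_apply`).

The lifting is `T x = ∑ n, e_n^*(x) • f n` for functions `f n ∈ FBL[X]` with pairwise disjoint
supports such that `0 ≤ f n ≤ |δ (e n)|` and `f n (e_m^*) = 1` if `m = n`, `0` otherwise. An explicit
choice is

  `f n = (|δ (e n)| - ∑ m, w n m • |δ (e m)|) ⊔ 0`

with nonnegative weights such that `w n n = 0`, `w n m * w m n = 1` for `n ≠ m`, and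
`∑ m, w n m * ‖e m‖ < ∞`: where `f n` and `f m` are both positive,
`|φ (e n)| > w n m * |φ (e m)| > w n m * w m n * |φ (e n)|` would follow (`FBL.bump_disjoint`).
Disjointness and positivity make `T` a lattice homomorphism, and the values at the `e_m^*` make it a
right inverse of the canonical map.

For `‖T x‖ ≤ ‖x‖`, let `φ` be an admissible family. By disjointness only one index `k i` contributes
to `T x (φ i)`, so that `∑ i, |T x (φ i)| ≤ ∑ i, |e_{k i}^*(x) * φ i (e (k i))|`. The right-hand side
is at most the average of `∑ i, |φ i (∑ n, ε n * e_n^*(x) • e n)|` over signs `ε`, hence at most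
`‖x‖` by 1-unconditionality (`sum_abs_coord_mul_le`).
-/

/-! ### Norm estimates for a 1-unconditional basis -/

namespace IsOneUnconditional

variable {X : Type*} [NormedAddCommGroup X] [NormedSpace ℝ X] {b : SchauderBasis ℝ X}

lemma coord_basis (b : SchauderBasis ℝ X) (m n : ℕ) :
    b.coord m (b n) = if m = n then 1 else 0 := by
  simp [b.ortho, Pi.single_apply]

lemma coord_sum_range (b : SchauderBasis ℝ X) (c : ℕ → ℝ) (N m : ℕ) :
    b.coord m (∑ i ∈ Finset.range N, c i • b i) = if m < N then c m else 0 := by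
  simp [coord_basis]

lemma sum_range_abs_le (hb : IsOneUnconditional b) {ψ : StrongDual ℝ X} (hψ : ‖ψ‖ ≤ 1) (v : X)
    (N : ℕ) : ∑ n ∈ Finset.range N, |ψ (b n)| * |b.coord n v| ≤ ‖v‖ := by
  set c : ℕ → ℝ := fun n => |b.coord n v| * SignType.sign (ψ (b n)) with hc
  have hcv : ∀ n, |c n| ≤ |b.coord n v| := fun n => by
    rw [hc, abs_mul, abs_abs]
    refine mul_le_of_le_one_right (abs_nonneg _) ?_
    rcases lt_trichotomy (ψ (b n)) 0 with h | h | h <;> simp [h]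
  calc ∑ n ∈ Finset.range N, |ψ (b n)| * |b.coord n v|
      = ψ (∑ n ∈ Finset.range N, c n • b n) := by
        rw [map_sum]
        refine Finset.sum_congr rfl fun n _ => ?_
        rw [map_smul, smul_eq_mul, hc, mul_assoc, sign_mul_self, mul_comm]
    _ ≤ ‖ψ‖ * ‖∑ n ∈ Finset.range N, c n • b n‖ := (le_abs_self _).trans (ψ.le_opNorm _)
    _ ≤ ‖∑ n ∈ Finset.range N, c n • b n‖ := mul_le_of_le_one_left (norm_nonneg _) hψ
    _ ≤ ‖v‖ := hb.norm_le fun n => by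
        rw [coord_sum_range]
        split_ifs
        · exact hcv n
        · simp

/-- If the coordinates of `x` are the values of `f ∈ H₀[X]` at the coordinate functionals, then
`‖x‖ ≤ ‖f‖`: a norming functional `ψ` of `x` yields the admissible families
`|ψ (e n)| • e_n^*`, `n < N`. -/
lemma norm_le_of_coord_eq (hb : IsOneUnconditional b) (f : H0 X) {x : X}
    (h : ∀ n, b.coord n x = f (b.coord n)) : ‖x‖ ≤ ‖f‖ := by
  obtain ⟨ψ, hψ, hx⟩ := exists_dual_vector'' ℝ x
  have hlim := (ψ.continuous.tendsto x).comp (tendsto_sum b x)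
  rw [hx] at hlim
  refine le_of_tendsto' hlim fun N => ?_
  have hadm : IsAdmissible fun i : Fin N => |ψ (b i)| • b.coord i := fun v hv => by
    rw [Fin.sum_univ_eq_sum_range (fun i => |(|ψ (b i)| • b.coord i) v|) N]
    simpa [abs_mul] using (hb.sum_range_abs_le hψ v N).trans hv
  refine le_trans ?_ (f.sum_abs_le_norm hadm)
  rw [Fin.sum_univ_eq_sum_range (fun i => |f (|ψ (b i)| • b.coord i)|) N, Function.comp_apply,
    map_sum]
  refine Finset.sum_le_sum fun n _ => ?_
  rw [map_smul, smul_eq_mul, h]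
  rcases (abs_nonneg (ψ (b n))).eq_or_lt with h0 | h0
  · rw [abs_eq_zero.1 h0.symm, mul_zero]
    exact abs_nonneg _
  · rw [f.2.1 _ h0, abs_mul, abs_abs, mul_comm, ← abs_mul]
    exact le_abs_self _

/-- For an admissible family `φ`, attach to each `φ i` one index `k i`; only the `k i`-th coordinate
of `x` is then seen by `φ i`. The bound is an average over changes of signs of the coordinates
of `x`, which leave the norm unchanged. -/
lemma sum_abs_coord_mul_le (hb : IsOneUnconditional b) {N : ℕ} {φ : Fin N → StrongDual ℝ X}
    (hφ : IsAdmissible φ) (k : Fin N → ℕ) (x : X) :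
    ∑ i, |b.coord (k i) x * φ i (b (k i))| ≤ ‖x‖ := by
  -- The signs are averaged out one coordinate at a time: `K` holds the coordinates treated so far.
  have key : ∀ (K : Finset ℕ) (x : X), ∑ i, (if k i ∈ K then |b.coord (k i) x * φ i (b (k i))|
      else |φ i (x - ∑ n ∈ K, b.coord n x • b n)|) ≤ ‖x‖ := by
    intro K
    induction K using Finset.induction_on with
    | empty =>
      intro x
      simpa using H0.sum_abs_le_norm (H0.eval x) hφ |>.trans
        (ENNReal.toReal_le_of_le_ofReal (norm_nonneg _) (freeENorm_eval_le x))
    | insert m K hm ih =>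
      intro x
      set y : X := x - (2 * b.coord m x) • b m with hy
      have hcoord : ∀ n, b.coord n y = if n = m then -b.coord m x else b.coord n x := fun n => by
        rw [hy, map_sub, map_smul, coord_basis]
        split_ifs with h
        · subst h; simp; ring
        · simp
      have hnorm : ‖y‖ ≤ ‖x‖ := hb.norm_le fun n => by
        rw [hcoord]
        split_ifs with h
        · simp [h]
        · exact le_rfl
      have hsum : ∑ n ∈ K, b.coord n y • b n = ∑ n ∈ K, b.coord n x • b n :=
        Finset.sum_congr rfl fun n hn => by rw [hcoord, if_neg (ne_of_mem_of_not_mem hn hm)]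
      have h2 := add_le_add (ih x) ((ih y).trans hnorm)
      rw [← Finset.sum_add_distrib] at h2
      refine le_of_mul_le_mul_left ?_ (two_pos : (0 : ℝ) < 2)
      rw [Finset.mul_sum, two_mul ‖x‖]
      refine (Finset.sum_le_sum fun i _ => ?_).trans h2
      by_cases hK : k i ∈ K
      · have hne : k i ≠ m := ne_of_mem_of_not_mem hK hm
        simp only [hK, Finset.mem_insert, or_true, if_true, hcoord, if_neg hne]
        exact (two_mul _).le
      · rw [if_neg hK, if_neg hK, hsum, Finset.sum_insert hm, hy]
        by_cases him : k i = m
        · rw [if_pos (by simp [him]), him]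
          simp only [map_sub, map_smul, smul_eq_mul]
          set p := φ i x
          set q := φ i (∑ n ∈ K, b.coord n x • b n)
          calc 2 * |b.coord m x * φ i (b m)|
              = |(p - q) - (p - 2 * b.coord m x * φ i (b m) - q)| := by
                rw [← abs_two, ← abs_mul, abs_two]; congr 1; ring
            _ ≤ _ := abs_sub _ _
        · rw [if_neg (by simp [him, hK])]
          simp only [map_sub, map_add, map_smul, smul_eq_mul]
          set p := φ i x
          set q := φ i (∑ n ∈ K, b.coord n x • b n)
          calc 2 * |p - (b.coord m x * φ i (b m) + q)|
              = |(p - q) + (p - 2 * b.coord m x * φ i (b m) - q)| := by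
                rw [← abs_two, ← abs_mul, abs_two]; congr 1; ring
            _ ≤ _ := abs_add_le _ _
  simpa using key (Finset.univ.image k) x

end IsOneUnconditional

/-! ### A disjoint sequence in `FBL[E]` -/

namespace FBL

variable {E : Type*} [NormedAddCommGroup E]

/-- The weight of `|δ (e m)|` in the `n`-th function of the disjoint sequence. It is chosen such
that `w n m * w m n = 1` for `n ≠ m`, and `∑ m, w n m * ‖e m‖ < ∞` for all `n`. -/
noncomputable def weight (e : ℕ → E) (n m : ℕ) : ℝ :=
  if m = n then 0 else if m < n then 2 ^ n * (1 + ‖e n‖) else (2 ^ m * (1 + ‖e m‖))⁻¹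

lemma weight_self (e : ℕ → E) (n : ℕ) : weight e n n = 0 := if_pos rfl

lemma weight_nonneg (e : ℕ → E) (n m : ℕ) : 0 ≤ weight e n m := by
  unfold weight
  split_ifs <;> positivity

lemma weight_mul_weight (e : ℕ → E) {n m : ℕ} (h : n ≠ m) : weight e n m * weight e m n = 1 := by
  wlog hlt : n < m generalizing n m
  · rw [mul_comm]
    exact this h.symm (lt_of_le_of_ne (not_lt.1 hlt) h.symm)
  rw [weight, weight, if_neg h.symm, if_neg hlt.not_gt, if_neg h, if_pos hlt]
  exact inv_mul_cancel₀ (by positivity)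

variable [NormedSpace ℝ E]

/-- Evaluation at a functional, as a bounded functional on `FBL[E]`. -/
noncomputable def evalAt (φ : StrongDual ℝ E) : FBL E →L[ℝ] ℝ :=
  LinearMap.mkContinuous
    { toFun := fun f => f.1 φ
      map_add' := fun _ _ => rfl
      map_smul' := fun _ _ => rfl } (‖φ‖ + 1) fun f => H0.abs_apply_le f.1 φ

lemma norm_abs_delta (x : E) : ‖|delta E x|‖ = ‖x‖ := by
  rw [norm_abs_eq_norm, LinearIsometry.norm_map]

lemma summable_weight (e : ℕ → E) (n : ℕ) :
    Summable fun m => weight e n m • |delta E (e m)| := by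
  refine Summable.of_norm_bounded_eventually_nat (g := fun m => ((1 : ℝ) / 2) ^ m)
    summable_geometric_two ?_
  filter_upwards [Filter.eventually_gt_atTop n] with m hm
  rw [norm_smul, norm_abs_delta, Real.norm_of_nonneg (weight_nonneg e n m), weight,
    if_neg hm.ne', if_neg hm.not_gt, mul_inv, one_div, inv_pow, mul_assoc]
  refine mul_le_of_le_one_right (by positivity) ?_
  rw [inv_mul_le_iff₀ (by positivity)]
  linarith [norm_nonneg (e m)]

/-- The positive part of `|δ (e n)| - ∑ m, w n m |δ (e m)|`, where `w` is `FBL.weight`. For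
different `n` these functions have disjoint supports. -/
noncomputable def bump (e : ℕ → E) (n : ℕ) : FBL E :=
  (|delta E (e n)| - ∑' m, weight e n m • |delta E (e m)|) ⊔ 0

lemma bump_apply (e : ℕ → E) (n : ℕ) (φ : StrongDual ℝ E) :
    (bump e n).1 φ = (|φ (e n)| - ∑' m, weight e n m * |φ (e m)|) ⊔ 0 := by
  have h : (∑' m, weight e n m • |delta E (e m)|).1 φ = ∑' m, weight e n m * |φ (e m)| :=
    (evalAt φ).map_tsum (summable_weight e n)
  rw [← h]
  rfl

lemma summable_weight_mul (e : ℕ → E) (n : ℕ) (φ : StrongDual ℝ E) :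
    Summable fun m => weight e n m * |φ (e m)| :=
  (evalAt φ).summable (summable_weight e n)

lemma bump_nonneg (e : ℕ → E) (n : ℕ) (φ : StrongDual ℝ E) : 0 ≤ (bump e n).1 φ := by
  rw [bump_apply]
  exact le_sup_right

lemma bump_le (e : ℕ → E) (n : ℕ) (φ : StrongDual ℝ E) : (bump e n).1 φ ≤ |φ (e n)| := by
  rw [bump_apply]
  refine sup_le (sub_le_self _ ?_) (abs_nonneg _)
  exact tsum_nonneg fun m => mul_nonneg (weight_nonneg e n m) (abs_nonneg _)

lemma weight_mul_lt_of_bump_ne_zero {e : ℕ → E} {n : ℕ} {φ : StrongDual ℝ E}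
    (h : (bump e n).1 φ ≠ 0) (m : ℕ) : weight e n m * |φ (e m)| < |φ (e n)| := by
  have h1 : weight e n m * |φ (e m)| ≤ ∑' m, weight e n m * |φ (e m)| :=
    (summable_weight_mul e n φ).le_tsum m fun j _ =>
      mul_nonneg (weight_nonneg e n j) (abs_nonneg _)
  contrapose! h
  rw [bump_apply, sup_eq_right]
  linarith

lemma bump_disjoint {e : ℕ → E} {n m : ℕ} (hnm : n ≠ m) {φ : StrongDual ℝ E}
    (h : (bump e n).1 φ ≠ 0) : (bump e m).1 φ = 0 := by
  by_contra h'
  have h1 := weight_mul_lt_of_bump_ne_zero h m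
  have h2 := weight_mul_lt_of_bump_ne_zero h' n
  have hpos : 0 < weight e n m := lt_of_le_of_ne (weight_nonneg e n m) fun h0 => by
    simpa [← h0] using weight_mul_weight e hnm
  have h3 := mul_lt_mul_of_pos_left h2 hpos
  rw [← mul_assoc, weight_mul_weight e hnm, one_mul] at h3
  exact lt_asymm h1 h3

lemma bump_apply_of_biorthogonal {e : ℕ → E} {φ : StrongDual ℝ E} {m : ℕ}
    (h : ∀ n, φ (e n) = if m = n then 1 else 0) (n : ℕ) :
    (bump e n).1 φ = if m = n then 1 else 0 := by
  split_ifs with hn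
  · subst hn
    have h0 : ∀ j, weight e m j * |φ (e j)| = 0 := fun j => by
      rw [h]
      split_ifs with hj
      · subst hj; simp [weight_self]
      · simp
    simp only [bump_apply, h0, tsum_zero]
    simp [h]
  · have := bump_le e n φ
    rw [h, if_neg hn, abs_zero] at this
    exact le_antisymm this (bump_nonneg e n φ)

end FBL

/-! ### The lifting defined by a disjoint sequence -/

namespace IsOneUnconditional

variable {X : Type*} [NormedAddCommGroup X] [NormedSpace ℝ X] {b : SchauderBasis ℝ X}

/-- An index `k` such that `FBL.bump b n` vanishes at `φ` for all `n ≠ k`. -/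
noncomputable def bumpIndex (b : SchauderBasis ℝ X) (φ : StrongDual ℝ X) : ℕ :=
  open Classical in if h : ∃ k, (FBL.bump b k).1 φ ≠ 0 then h.choose else 0

lemma bump_eq_zero (b : SchauderBasis ℝ X) {φ : StrongDual ℝ X} {n : ℕ} (h : n ≠ bumpIndex b φ) :
    (FBL.bump b n).1 φ = 0 := by
  by_cases hk : ∃ k, (FBL.bump b k).1 φ ≠ 0
  · rw [bumpIndex, dif_pos hk] at h
    exact FBL.bump_disjoint h.symm hk.choose_spec
  · push Not at hk
    exact hk n

/-- The pointwise sum `∑ n, e_n^*(x) • FBL.bump b n`, which has at most one nonzero term at each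
functional. -/
noncomputable def liftFun (b : SchauderBasis ℝ X) (x : X) (φ : StrongDual ℝ X) : ℝ :=
  b.coord (bumpIndex b φ) x * (FBL.bump b (bumpIndex b φ)).1 φ

lemma isPosHomogeneous_liftFun (b : SchauderBasis ℝ X) (x : X) : IsPosHomogeneous (liftFun b x) := by
  intro c hc φ
  have hsmul : ∀ n, (FBL.bump b n).1 (c • φ) = c * (FBL.bump b n).1 φ :=
    fun n => (FBL.bump b n).1.2.1 c hc φ
  by_cases h : bumpIndex b (c • φ) = bumpIndex b φ
  · rw [liftFun, liftFun, h, hsmul]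
    ring
  -- If the two chosen indices differ, then both functions vanish.
  · have h1 := bump_eq_zero b h
    have h2 := bump_eq_zero b (Ne.symm h)
    rw [hsmul, mul_eq_zero, or_iff_right hc.ne'] at h2
    rw [liftFun, liftFun, hsmul, h1, h2]
    ring

lemma freeENorm_liftFun_le (hb : IsOneUnconditional b) (x : X) :
    freeENorm (liftFun b x) ≤ ENNReal.ofReal ‖x‖ :=
  freeENorm_le fun n φ hφ => by
    rw [← ENNReal.ofReal_sum_of_nonneg fun _ _ => abs_nonneg _]
    refine ENNReal.ofReal_le_ofReal (le_trans (Finset.sum_le_sum fun i _ => ?_)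
      (hb.sum_abs_coord_mul_le hφ (fun i => bumpIndex b (φ i)) x))
    rw [liftFun, abs_mul, abs_mul]
    refine mul_le_mul_of_nonneg_left ?_ (abs_nonneg _)
    rw [abs_of_nonneg (FBL.bump_nonneg _ _ _)]
    exact FBL.bump_le _ _ _

/-- The map `x ↦ ∑ n, e_n^*(x) • FBL.bump b n` into `H₀[X]`. -/
noncomputable def liftH0 (hb : IsOneUnconditional b) : X →L[ℝ] H0 X :=
  LinearMap.mkContinuous
    { toFun := fun x => ⟨liftFun b x, isPosHomogeneous_liftFun b x,
        (hb.freeENorm_liftFun_le x).trans_lt ENNReal.ofReal_lt_top⟩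
      map_add' := fun x y => H0.ext fun φ => by
        change b.coord _ (x + y) * _ = b.coord _ x * _ + b.coord _ y * _
        rw [map_add, add_mul]
      map_smul' := fun c x => H0.ext fun φ => by
        change b.coord _ (c • x) * _ = c * (b.coord _ x * _)
        rw [map_smul, smul_eq_mul, mul_assoc] } 1 fun x => by
    rw [one_mul]
    exact ENNReal.toReal_le_of_le_ofReal (norm_nonneg _) (hb.freeENorm_liftFun_le x)

lemma liftH0_apply (hb : IsOneUnconditional b) (x : X) (φ : StrongDual ℝ X) :
    hb.liftH0 x φ = b.coord (bumpIndex b φ) x * (FBL.bump b (bumpIndex b φ)).1 φ := rfl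

lemma liftH0_basis (hb : IsOneUnconditional b) (n : ℕ) : hb.liftH0 (b n) = (FBL.bump b n).1 := by
  ext φ
  rw [liftH0_apply, coord_basis]
  split_ifs with h
  · rw [h, one_mul]
  · rw [bump_eq_zero b (Ne.symm h), zero_mul]

lemma liftH0_mem (hb : IsOneUnconditional b) (x : X) : hb.liftH0 x ∈ FBL X := by
  refine FBL.isClosed.mem_of_tendsto ((hb.liftH0.continuous.tendsto x).comp (tendsto_sum b x))
    (Filter.Eventually.of_forall fun N => ?_)
  rw [Function.comp_apply, map_sum]
  refine Submodule.sum_mem _ fun n _ => ?_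
  rw [map_smul, liftH0_basis]
  exact Submodule.smul_mem _ _ (FBL.bump b n).2

/-- The lifting `X → FBL[X]`, `x ↦ ∑ n, e_n^*(x) • FBL.bump b n`. -/
noncomputable def lift (hb : IsOneUnconditional b) : X →L[ℝ] FBL X :=
  hb.liftH0.codRestrict (FBL X) hb.liftH0_mem

lemma lift_apply (hb : IsOneUnconditional b) (x : X) (φ : StrongDual ℝ X) :
    (hb.lift x).1 φ = b.coord (bumpIndex b φ) x * (FBL.bump b (bumpIndex b φ)).1 φ := rfl

lemma lift_apply_coord (hb : IsOneUnconditional b) (x : X) (n : ℕ) :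
    (hb.lift x).1 (b.coord n) = b.coord n x := by
  have h := FBL.bump_apply_of_biorthogonal (e := b) (coord_basis b n)
  have hn : n = bumpIndex b (b.coord n) := by
    by_contra hne
    simpa [h] using bump_eq_zero b hne
  rw [lift_apply, ← hn, h, if_pos rfl, mul_one]

lemma norm_lift_le (hb : IsOneUnconditional b) : ‖hb.lift‖ ≤ 1 :=
  hb.lift.opNorm_le_bound zero_le_one fun x => by
    rw [one_mul]
    exact ENNReal.toReal_le_of_le_ofReal (norm_nonneg _) (hb.freeENorm_liftFun_le x)

/-! ### The canonical map `FBL[X] → X` -/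

variable [CompleteSpace X]

lemma coord_sup (hb : IsOneUnconditional b) (x y : X) (n : ℕ) :
    b.coord n (hb.coordinatewiseLattice.sup x y) = b.coord n x ⊔ b.coord n y := by
  change b.coord n ((2⁻¹ : ℝ) • (x + y + hb.absVec (x - y))) = _
  rw [map_smul, map_add, map_add, coord_absVec, map_sub,
    sup_eq_half_smul_add_add_abs_sub' ℝ, smul_eq_mul, smul_eq_mul, abs_sub_comm]

lemma coord_inf (hb : IsOneUnconditional b) (x y : X) (n : ℕ) :
    b.coord n (hb.coordinatewiseLattice.inf x y) = b.coord n x ⊓ b.coord n y := by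
  change b.coord n ((2⁻¹ : ℝ) • (x + y - hb.absVec (x - y))) = _
  rw [map_smul, map_sub, map_add, coord_absVec, map_sub,
    inf_eq_half_smul_add_sub_abs_sub' ℝ, smul_eq_mul, smul_eq_mul, abs_sub_comm]

/-- For `f ∈ FBL[X]` the sequence `f (e_n^*)` is the coordinate sequence of a vector, since the
`f ∈ H₀[X]` with this property form a closed sublattice that contains the evaluations. -/
lemma exists_coord_eq_apply (hb : IsOneUnconditional b) (f : FBL X) :
    ∃ x : X, ∀ n, b.coord n x = f.1 (b.coord n) := by
  let S : Submodule ℝ (H0 X) :=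
    { carrier := {f | ∃ x : X, ∀ n, b.coord n x = f (b.coord n)}
      zero_mem' := ⟨0, fun n => by simp⟩
      add_mem' := fun ⟨x, hx⟩ ⟨y, hy⟩ => ⟨x + y, fun n => by simp [hx, hy]⟩
      smul_mem' := fun c _ ⟨x, hx⟩ => ⟨c • x, fun n => by simp [hx]⟩ }
  have hle : FBL X ≤ S := by
    refine sInf_le ⟨isClosed_of_closure_subset fun g hg => ?_,
      fun g ⟨x, hx⟩ h ⟨y, hy⟩ => ⟨⟨hb.coordinatewiseLattice.sup x y, fun n => ?_⟩,
        ⟨hb.coordinatewiseLattice.inf x y, fun n => ?_⟩⟩, fun x => ⟨x, fun n => rfl⟩⟩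
    · obtain ⟨u, huS, hu⟩ := mem_closure_iff_seq_limit.1 hg
      choose x hx using huS
      have hcauchy : CauchySeq x := by
        rw [Metric.cauchySeq_iff']
        intro ε hε
        obtain ⟨N, hN⟩ := Metric.cauchySeq_iff'.1 hu.cauchySeq ε hε
        refine ⟨N, fun n hn => lt_of_le_of_lt ?_ (hN n hn)⟩
        rw [dist_eq_norm, dist_eq_norm]
        exact hb.norm_le_of_coord_eq _ fun m => by simp [hx]
      obtain ⟨y, hy⟩ := cauchySeq_tendsto_of_complete hcauchy
      refine ⟨y, fun n => ?_⟩
      refine tendsto_nhds_unique (((b.coord n).continuous.tendsto y).comp hy) ?_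
      rw [tendsto_iff_norm_sub_tendsto_zero] at hu ⊢
      refine squeeze_zero (fun _ => norm_nonneg _) (fun k => ?_)
        (by simpa using hu.const_mul (‖b.coord n‖ + 1))
      rw [Function.comp_apply, hx, Real.norm_eq_abs]
      exact H0.abs_apply_le (u k - g) (b.coord n)
    · rw [coord_sup, hx, hy, H0.sup_apply]
    · rw [coord_inf, hx, hy, H0.inf_apply]
  exact hle f.2

/-- The map `FBL[X] → X` that sends `f` to the vector with coordinates `f (e_n^*)`. -/
noncomputable def canonicalMap (hb : IsOneUnconditional b) : FBL X →L[ℝ] X :=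
  LinearMap.mkContinuous
    { toFun := fun f => (hb.exists_coord_eq_apply f).choose
      map_add' := fun f g => coord_ext b fun n => by
        rw [map_add]
        simp only [fun f => (hb.exists_coord_eq_apply f).choose_spec n]
        rfl
      map_smul' := fun c f => coord_ext b fun n => by
        rw [map_smul]
        simp only [fun f => (hb.exists_coord_eq_apply f).choose_spec n]
        rfl } 1 fun f => by
    rw [one_mul]
    exact hb.norm_le_of_coord_eq f.1 (hb.exists_coord_eq_apply f).choose_spec

lemma coord_canonicalMap (hb : IsOneUnconditional b) (f : FBL X) (n : ℕ) :
    b.coord n (hb.canonicalMap f) = f.1 (b.coord n) :=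
  (hb.exists_coord_eq_apply f).choose_spec n

lemma norm_canonicalMap_apply_le (hb : IsOneUnconditional b) (f : FBL X) :
    ‖hb.canonicalMap f‖ ≤ ‖f‖ :=
  hb.norm_le_of_coord_eq f.1 (hb.coord_canonicalMap f)

lemma canonicalMap_lift (hb : IsOneUnconditional b) (x : X) : hb.canonicalMap (hb.lift x) = x :=
  coord_ext b fun n => by rw [coord_canonicalMap, lift_apply_coord]

lemma norm_lift (hb : IsOneUnconditional b) : ‖hb.lift‖ = 1 := by
  refine le_antisymm hb.norm_lift_le ?_
  have hpos : 0 < ‖b 0‖ := norm_pos_iff.2 fun h => by simpa [h] using coord_basis b 0 0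
  have h := (hb.norm_canonicalMap_apply_le (hb.lift (b 0))).trans (hb.lift.le_opNorm (b 0))
  rw [canonicalMap_lift] at h
  exact (le_mul_iff_one_le_left hpos).1 h

end IsOneUnconditional

theorem theorem4p1 {X : Type*} [NormedAddCommGroup X] [NormedSpace ℝ X] [CompleteSpace X]
    (b : SchauderBasis ℝ X) (hb : IsOneUnconditional b) :
    letI : Lattice X := hb.coordinatewiseLattice
    haveI : IsBanachLattice X := hb.isBanachLattice
    HasIsometricLatticeLifting X := by
  let _ : Lattice X := hb.coordinatewiseLattice
  refine ⟨hb.canonicalMap, ⟨⟨fun f g => ?_, fun f g => ?_⟩, fun x => ?_⟩, hb.lift,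
    ⟨fun x y => ?_, fun x y => ?_⟩, ContinuousLinearMap.ext hb.canonicalMap_lift, hb.norm_lift⟩
  · refine IsOneUnconditional.coord_ext b fun n => ?_
    refine Eq.trans ?_ (hb.coord_sup _ _ n).symm
    simp only [hb.coord_canonicalMap, FBL.coe_sup, H0.sup_apply]
  · refine IsOneUnconditional.coord_ext b fun n => ?_
    refine Eq.trans ?_ (hb.coord_inf _ _ n).symm
    simp only [hb.coord_canonicalMap, FBL.coe_inf, H0.inf_apply]
  · exact IsOneUnconditional.coord_ext b fun n => hb.coord_canonicalMap _ n
  · refine Subtype.ext (H0.ext fun φ => ?_)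
    rw [FBL.coe_sup, H0.sup_apply, hb.lift_apply, hb.lift_apply, hb.lift_apply]
    exact (congrArg (· * _) (hb.coord_sup x y _)).trans
      (max_mul_of_nonneg _ _ (FBL.bump_nonneg _ _ _))
  · refine Subtype.ext (H0.ext fun φ => ?_)
    rw [FBL.coe_inf, H0.inf_apply, hb.lift_apply, hb.lift_apply, hb.lift_apply]
    exact (congrArg (· * _) (hb.coord_inf x y _)).trans
      (min_mul_of_nonneg _ _ (FBL.bump_nonneg _ _ _))
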